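/- For a real random variable $X$ with Lebesgue density $f$, let $h(X)=-\int_{\mathbb R} f(x)\log f(x)\,dx\in[-\infty,\infty]$ be its differential entropy, with the convention $h(X)=-\infty$ whenever this integral does not exist or $X$ has no density; $h(X)$ is called finite if $-\infty<h(X)<\infty$. Let $I(X)=\int_{\mathbb R}\frac{(f'(x))^2}{f(x)}\,dx\in[0,\infty]$ be the Fisher information of $X$ if $X$ has a (locally) absolutely continuous density $f$, and $I(X)=\infty$ otherwise. Theorem (De Bruijn's identity without finite variance). Let $X$ be a real random variable with $h(X)<\infty$ (the value $-\infty$ is allowed), for which there exists a random variable $Y$, independent of $X$ (possibly after replacing $X$ by a copy with the same law on another probability space), such that $h(Y)$ is finite and $h(X+Y)$ exists and is finite. Let $Z\sim\mathcal N(0,1)$ be independent of $X$. Then for every $t>0$ the entropy $h(X+\sqrt t\,Z)$ and the Fisher information $I(X+\sqrt t\,Z)$ are finite, the function $s\mapsto h(X+\sqrt s\,Z)$ is differentiable at $t$, and $$\frac{d}{dt}h(X+\sqrt t\,Z)=\frac12 I(X+\sqrt t\,Z).$$ -/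

import Mathlib

open MeasureTheory ProbabilityTheory

noncomputable section

namespace DeBruijn

/-- The Lebesgue density of a measure `μ` on `ℝ` (meaningful when `μ ≪ volume`). -/
def density (μ : Measure ℝ) (x : ℝ) : ℝ := (μ.rnDeriv volume x).toReal

/-- `∫ (-f log f)⁺ dx`, for the density `f` of `μ`. -/
def entropyPos (μ : Measure ℝ) : ENNReal :=
  ∫⁻ x, ENNReal.ofReal (Real.negMulLog (density μ x))

/-- `∫ (-f log f)⁻ dx`, for the density `f` of `μ`. -/
def entropyNeg (μ : Measure ℝ) : ENNReal :=
  ∫⁻ x, ENNReal.ofReal (-Real.negMulLog (density μ x))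

open Classical in
/-- Differential entropy `-∫ f log f dx ∈ [-∞, ∞]` of a law on `ℝ` with density `f`. The integral
exists if at least one of the integrals of the positive and the negative part of the integrand is
finite; by convention the entropy is `-∞` when it does not exist, or when there is no density. -/
def lawEntropy (μ : Measure ℝ) : EReal :=
  if μ ≪ volume ∧ (entropyPos μ ≠ ⊤ ∨ entropyNeg μ ≠ ⊤) then
    (entropyPos μ : EReal) - (entropyNeg μ : EReal)
  else ⊥

/-- `f` is an absolutely continuous density of `μ`: it is nonnegative, absolutely continuous on
every compact interval, and a Lebesgue density of `μ`. -/
structure IsACDensity (μ : Measure ℝ) (f : ℝ → ℝ) : Prop where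
  nonneg : ∀ x, 0 ≤ f x
  absCont : ∀ a b : ℝ, AbsolutelyContinuousOnInterval f a b
  eq_withDensity : μ = volume.withDensity (fun x => ENNReal.ofReal (f x))

/-- The integral `∫ (f')² / f dx ∈ [0, ∞]`. For an absolutely continuous `f ≥ 0` the derivative
exists almost everywhere, and it vanishes almost everywhere on the set where `f = 0`. -/
def fisherIntegral (f : ℝ → ℝ) : ENNReal :=
  ∫⁻ x, ENNReal.ofReal ((deriv f x) ^ 2 / f x)

open Classical in
/-- Fisher information of a law on `ℝ`: `∫ (f')² / f dx` if there is an absolutely continuous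
density `f` (which is then unique, see `IsACDensity.unique`), and `∞` otherwise. -/
def lawFisherInfo (μ : Measure ℝ) : ENNReal :=
  if h : ∃ f, IsACDensity μ f then fisherIntegral h.choose else ⊤

theorem IsACDensity.continuous {μ : Measure ℝ} {f : ℝ → ℝ} (hf : IsACDensity μ f) :
    Continuous f := by
  rw [continuous_iff_continuousAt]
  intro x
  refine ((hf.absCont (x - 1) (x + 1)).continuousOn).continuousAt ?_
  rw [Set.uIcc_of_le (by linarith)]
  exact Icc_mem_nhds (by linarith) (by linarith)

theorem IsACDensity.unique {μ : Measure ℝ} {f g : ℝ → ℝ} (hf : IsACDensity μ f)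
    (hg : IsACDensity μ g) : f = g := by
  have h := hf.eq_withDensity.symm.trans hg.eq_withDensity
  have hmf : Measurable (fun x => ENNReal.ofReal (f x)) := hf.continuous.measurable.ennreal_ofReal
  have hmg : Measurable (fun x => ENNReal.ofReal (g x)) := hg.continuous.measurable.ennreal_ofReal
  have h2 := (withDensity_eq_iff_of_sigmaFinite hmf.aemeasurable hmg.aemeasurable).1 h
  refine Measure.eq_of_ae_eq (μ := (volume : Measure ℝ)) ?_ hf.continuous hg.continuous
  filter_upwards [h2] with x hx
  exact (ENNReal.ofReal_eq_ofReal_iff (hf.nonneg x) (hg.nonneg x)).1 hx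

theorem lawFisherInfo_eq {μ : Measure ℝ} {f : ℝ → ℝ} (hf : IsACDensity μ f) :
    lawFisherInfo μ = fisherIntegral f := by
  have h : ∃ f, IsACDensity μ f := ⟨f, hf⟩
  rw [lawFisherInfo, dif_pos h, h.choose_spec.unique hf]

/-- Differential entropy `h(X)` of a real random variable: the entropy of its law. -/
def entropy {Ω : Type*} [MeasurableSpace Ω] (P : Measure Ω) (X : Ω → ℝ) : EReal :=
  lawEntropy (P.map X)

/-- Fisher information `I(X)` of a real random variable. -/
def fisherInfo {Ω : Type*} [MeasurableSpace Ω] (P : Measure Ω) (X : Ω → ℝ) : ENNReal :=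
  lawFisherInfo (P.map X)

/-- The entropy of `X` exists and is finite (it is `-∞` when it does not exist). -/
def HasFiniteEntropy {Ω : Type*} [MeasurableSpace Ω] (P : Measure Ω) (X : Ω → ℝ) : Prop :=
  entropy P X ≠ ⊥ ∧ entropy P X ≠ ⊤

end DeBruijn

end

/-! Let `μ` be the law of `X` and `p` the density of `X + √t Z`. By the heat equation the time
derivative of `-∫ p log p` is formally `-(1/2) ∫ p'' (log p + 1)`, and integration by parts turns
this into `(1/2) ∫ p'² / p`. The difficulty is to dominate `|log p|` times `p`, `p'` and `p''`,
locally uniformly in `t`, without any moment of `X`.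

Since `p` is bounded above, only a lower bound is missing. Mass of `μ` near `y` gives `p x ≥ C exp
(-(|x - y| + L)² / (2a)) μ [y - L, y + L]` for every `y`. Taking for `y` the variable of the
convolution integral, one pays only a factor `(1 + (x - y)²) (1 + l y)` with `l y = -log μ [y - L, y
+ L]`. The Gaussian absorbs the quadratic, and Tonelli leaves the single requirement that `l` be
`μ`-integrable (`exists_abs_log_heatFlow_le`, `exists_integrable_majorant`).

This is what the entropy of `X + Y` provides (`exists_hasLogIntegrableBalls`). A bounded, compactly
supported piece `q` of the density of `Y` yields a part `a` of the density `g` of `X + Y` with `a x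
≤ M μ [x - M, x + M]`. Hence `-a log μ [x - M, x + M]` is controlled by `|g log g| + C g`, and
Tonelli converts its integral into a bound on `∫ l dμ`. -/

noncomputable section

namespace DeBruijn

/-! ### Densities of convolutions and finiteness of entropy. -/

/-- The convolution of a measure with an absolutely continuous one is absolutely continuous. -/
theorem conv_withDensity (μ : Measure ℝ) [SFinite μ] {r : ℝ → ENNReal} (hr : Measurable r) :
    μ ∗ (volume.withDensity r) = volume.withDensity (fun x => ∫⁻ y, r (x - y) ∂μ) := by
  ext s hs
  have hm : Measurable (s.indicator (1 : ℝ → ENNReal)) := measurable_one.indicator hs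
  rw [← lintegral_indicator_one hs, Measure.lintegral_conv hm, withDensity_apply _ hs]
  have h1 : ∀ y, ∫⁻ u, s.indicator (1 : ℝ → ENNReal) (y + u) ∂(volume.withDensity r)
      = ∫⁻ x, s.indicator (1 : ℝ → ENNReal) x * r (x - y) := by
    intro y
    rw [lintegral_withDensity_eq_lintegral_mul _ hr
      (show Measurable fun u => s.indicator (1 : ℝ → ENNReal) (y + u) by fun_prop),
      ← lintegral_sub_right_eq_self _ y]
    refine lintegral_congr fun x => ?_
    simp [mul_comm]
  simp_rw [h1]
  rw [lintegral_lintegral_swap (by fun_prop), ← lintegral_indicator hs]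
  refine lintegral_congr fun x => ?_
  rw [lintegral_const_mul _ (by fun_prop)]
  by_cases hx : x ∈ s <;> simp [hx]

theorem density_withDensity_ofReal {f : ℝ → ℝ} (hf : Measurable f) (h0 : ∀ x, 0 ≤ f x) :
    density (volume.withDensity fun x => ENNReal.ofReal (f x)) =ᵐ[volume] f := by
  filter_upwards [Measure.rnDeriv_withDensity volume hf.ennreal_ofReal] with x hx
  rw [density, hx, ENNReal.toReal_ofReal (h0 x)]

theorem measurable_density (μ : Measure ℝ) : Measurable (density μ) :=
  (Measure.measurable_rnDeriv μ volume).ennreal_toReal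

theorem density_nonneg (μ : Measure ℝ) (x : ℝ) : 0 ≤ density μ x := ENNReal.toReal_nonneg

theorem lawEntropy_eq_integral {μ : Measure ℝ} (hμ : μ ≪ volume)
    (h : Integrable fun x => Real.negMulLog (density μ x)) :
    lawEntropy μ = ((∫ x, Real.negMulLog (density μ x) : ℝ) : EReal) := by
  have hp : entropyPos μ ≠ ⊤ := (h.lintegral_lt_top).ne
  have hn : entropyNeg μ ≠ ⊤ := (h.neg.lintegral_lt_top).ne
  rw [lawEntropy, if_pos ⟨hμ, Or.inl hp⟩, integral_eq_lintegral_pos_part_sub_lintegral_neg_part h,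
    EReal.coe_sub]
  congr 1
  · exact (EReal.coe_ennreal_toReal hp).symm
  · exact (EReal.coe_ennreal_toReal hn).symm

theorem absolutelyContinuous_of_lawEntropy_ne_bot {μ : Measure ℝ} (h : lawEntropy μ ≠ ⊥) :
    μ ≪ volume := by
  by_contra hμ
  exact h (if_neg fun h' => hμ h'.1)

theorem integrable_negMulLog_density {μ : Measure ℝ} (hbot : lawEntropy μ ≠ ⊥)
    (htop : lawEntropy μ ≠ ⊤) : Integrable fun x => Real.negMulLog (density μ x) := by
  have hc : μ ≪ volume ∧ (entropyPos μ ≠ ⊤ ∨ entropyNeg μ ≠ ⊤) := by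
    by_contra hμ
    exact hbot (if_neg hμ)
  rw [lawEntropy, if_pos hc] at hbot htop
  -- The negative part comes first: in `EReal`, subtracting `⊤` gives `⊥` even from `⊤`.
  have hn : entropyNeg μ ≠ ⊤ := by
    intro hn
    simp [hn] at hbot
  have hp : entropyPos μ ≠ ⊤ := by
    intro hp
    rw [hp] at htop
    lift entropyNeg μ to NNReal using hn with v
    exact htop rfl
  have hm : Measurable fun x => Real.negMulLog (density μ x) :=
    Real.continuous_negMulLog.measurable.comp (measurable_density μ)
  refine ⟨hm.aestronglyMeasurable, ?_⟩
  rw [hasFiniteIntegral_iff_norm]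
  calc ∫⁻ x, ENNReal.ofReal ‖Real.negMulLog (density μ x)‖
      ≤ ∫⁻ x, (ENNReal.ofReal (Real.negMulLog (density μ x))
          + ENNReal.ofReal (-Real.negMulLog (density μ x))) := by
        refine lintegral_mono fun x => ?_
        rcases le_total 0 (Real.negMulLog (density μ x)) with h | h
        · simp [Real.norm_of_nonneg h]
        · simp [Real.norm_of_nonpos h]
    _ = entropyPos μ + entropyNeg μ := lintegral_add_left hm.ennreal_ofReal _
    _ < ⊤ := ENNReal.add_lt_top.2 ⟨hp.lt_top, hn.lt_top⟩

/-! ### Integrability of the logarithmic mass of balls. -/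

/-- The logarithmic mass `-log μ [y - L, y + L]` of the balls of radius `L` has a `μ`-integrable
majorant. -/
def HasLogIntegrableBalls (μ : Measure ℝ) (L : ℝ) (l : ℝ → ℝ) : Prop :=
  Integrable l μ ∧ (∀ y, 0 ≤ l y) ∧
    ∀ᵐ y ∂μ, Real.exp (-l y) ≤ μ.real (Set.Icc (y - L) (y + L))

theorem measurable_measure_Icc (μ : Measure ℝ) [SFinite μ] (L : ℝ) :
    Measurable fun y => μ (Set.Icc (y - L) (y + L)) := by
  have hs : MeasurableSet {p : ℝ × ℝ | p.1 - L ≤ p.2 ∧ p.2 ≤ p.1 + L} :=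
    (measurableSet_le (f := fun p : ℝ × ℝ => p.1 - L) (g := fun p => p.2)
      (by fun_prop) (by fun_prop)).inter
      (measurableSet_le (f := fun p : ℝ × ℝ => p.2) (g := fun p => p.1 + L)
        (by fun_prop) (by fun_prop))
  exact measurable_measure_prodMk_left hs

/-- Almost every point lies in the support of `μ`. This makes `exp (log ·)` cancel later, in spite
of `Real.log 0 = 0`. -/
theorem ae_measure_Icc_pos (μ : Measure ℝ) {L : ℝ} (hL : 0 < L) :
    ∀ᵐ y ∂μ, 0 < μ (Set.Icc (y - L) (y + L)) := by
  filter_upwards [Measure.support_mem_ae (μ := μ)] with y hy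
  exact (Measure.mem_support_iff_forall y).1 hy _ (Icc_mem_nhds (by linarith) (by linarith))

/-- If `a ≤ M m` is a part of `g`, then `-a log m` is controlled by `g log g`. -/
theorem mul_neg_log_le {a g m M : ℝ} (ha : 0 ≤ a) (hag : a ≤ g) (hM : 0 < M) (hm : 0 ≤ m)
    (ham : a ≤ M * m) :
    a * -Real.log m ≤ |Real.negMulLog g| + g * (1 + |Real.log M|) := by
  have hg : 0 ≤ g := ha.trans hag
  rcases ha.eq_or_lt with rfl | ha
  · rw [zero_mul]; positivity
  have hg' : 0 < g := ha.trans_le hag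
  have hm' : 0 < m := by
    rcases hm.eq_or_lt with rfl | h
    · simp at ham; linarith
    · exact h
  -- Decomposition: `-a log m ≤ a log M - a log a = a log M + a (log g - log a) - a log g`. The
  -- middle term is at most `g - a`, since `log z ≤ z - 1`.
  have h1 : Real.log a ≤ Real.log M + Real.log m := by
    rw [← Real.log_mul hM.ne' hm'.ne']
    exact Real.log_le_log ha ham
  have h2 : Real.log g - Real.log a ≤ g / a - 1 := by
    rw [← Real.log_div hg'.ne' ha.ne']
    exact Real.log_le_sub_one_of_pos (by positivity)
  have h3 : a * (Real.log g - Real.log a) ≤ g - a := by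
    calc _ ≤ a * (g / a - 1) := by gcongr
      _ = g - a := by field_simp
  have h4 : -(a * Real.log g) ≤ |Real.negMulLog g| := by
    have : |Real.negMulLog g| = g * |Real.log g| := by
      rw [Real.negMulLog, abs_mul, abs_neg, abs_of_pos hg']
    rw [this]
    calc -(a * Real.log g) = a * -Real.log g := by ring
      _ ≤ a * |Real.log g| := by gcongr; exact neg_le_abs _
      _ ≤ _ := by gcongr
  have h5 : a * Real.log M ≤ g * |Real.log M| := by
    calc a * Real.log M ≤ a * |Real.log M| := by gcongr; exact le_abs_self _
      _ ≤ _ := by gcongr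
  nlinarith [mul_le_mul_of_nonneg_left h1 ha.le]

theorem measurableSet_truncation {r : ℝ → ENNReal} (hr : Measurable r) (M : ℝ) :
    MeasurableSet {u | |u| ≤ M ∧ r u ≤ ENNReal.ofReal M} :=
  (measurableSet_le (f := fun u : ℝ => |u|) (g := fun _ => M) (by fun_prop) (by fun_prop)).inter
    (measurableSet_le hr measurable_const)

/-- A finite measure that is absolutely continuous and nonzero has mass on a bounded set on which
its density is bounded. -/
theorem exists_lintegral_truncation_ne_zero {r : ℝ → ENNReal} (hr : Measurable r)
    (htop : ∀ᵐ u, r u < ⊤) (h0 : ∫⁻ u, r u ≠ 0) :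
    ∃ M : ℝ, 0 < M ∧
      ∫⁻ u, {u | |u| ≤ M ∧ r u ≤ ENNReal.ofReal M}.indicator r u ≠ 0 := by
  -- The truncation sets exhaust `{r < ⊤}`, so if every truncated integral vanished, `r` would
  -- vanish almost everywhere.
  by_contra! hcon
  apply h0
  have hz : ∀ n : ℕ, ∀ᵐ u, {u | |u| ≤ (n + 1 : ℝ) ∧ r u ≤ ENNReal.ofReal (n + 1)}.indicator r u
      = 0 := fun n => by
    have := hcon (n + 1) (by positivity)
    rwa [lintegral_eq_zero_iff (hr.indicator (measurableSet_truncation hr _))] at this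
  rw [lintegral_eq_zero_iff hr]
  filter_upwards [ae_all_iff.2 hz, htop] with u hu hut
  obtain ⟨n, hn⟩ := exists_nat_ge (max |u| (r u).toReal)
  have hn1 : |u| ≤ (n + 1 : ℝ) := (le_max_left _ _).trans (hn.trans (by linarith))
  have hn2 : r u ≤ ENNReal.ofReal (n + 1) := by
    rw [← ENNReal.ofReal_toReal hut.ne]
    exact ENNReal.ofReal_le_ofReal ((le_max_right _ _).trans (hn.trans (by linarith)))
  have := hu n
  rwa [Set.indicator_of_mem] at this
  exact ⟨hn1, hn2⟩

/-- If some convolution of `μ` with an absolutely continuous law has finite entropy, then the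
logarithmic mass of balls is `μ`-integrable. -/
theorem exists_hasLogIntegrableBalls (μ ν : Measure ℝ) [IsProbabilityMeasure μ]
    [IsProbabilityMeasure ν] (hν : ν ≪ volume)
    (hint : Integrable fun x => Real.negMulLog (density (μ ∗ ν) x)) :
    ∃ L l, 0 < L ∧ HasLogIntegrableBalls μ L l := by
  set r := ν.rnDeriv volume with hr_def
  have hr : Measurable r := Measure.measurable_rnDeriv _ _
  have hνr : ν = volume.withDensity r := (Measure.withDensity_rnDeriv_eq _ _ hν).symm
  have hr0 : ∫⁻ u, r u ≠ 0 := by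
    rw [← setLIntegral_univ, ← withDensity_apply _ MeasurableSet.univ, ← hνr]
    simp
  obtain ⟨M, hM, hMne⟩ :=
    exists_lintegral_truncation_ne_zero hr (Measure.rnDeriv_lt_top _ _) hr0
  set A := {u | |u| ≤ M ∧ r u ≤ ENNReal.ofReal M} with hA
  have hAm : MeasurableSet A := measurableSet_truncation hr M
  set q := A.indicator r with hq
  have hqm : Measurable q := hr.indicator hAm
  set m : ℝ → ℝ → ENNReal := fun L y => μ (Set.Icc (y - L) (y + L)) with hm
  have hmm : ∀ L, Measurable (m L) := fun L => measurable_measure_Icc μ L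
  -- The radius is `2 * M` because `|x - y| ≤ M` implies `[x - M, x + M] ⊆ [y - 2M, y + 2M]`; thus
  -- `l y` is at most the logarithmic mass at `x`.
  set l : ℝ → ℝ := fun y => -Real.log (m (2 * M) y).toReal with hl
  have hlm : Measurable l := (Real.measurable_log.comp (hmm _).ennreal_toReal).neg
  have hm1 : ∀ L y, (m L y).toReal ≤ 1 := fun L y => measureReal_le_one
  have hl0 : ∀ y, 0 ≤ l y := fun y =>
    neg_nonneg.2 (Real.log_nonpos ENNReal.toReal_nonneg (hm1 _ _))
  set g := density (μ ∗ ν) with hg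
  have hgd : ∀ᵐ x, ∫⁻ y, r (x - y) ∂μ = ENNReal.ofReal (g x) := by
    have h1 : μ ∗ ν = volume.withDensity (fun x => ∫⁻ y, r (x - y) ∂μ) := by
      conv_lhs => rw [hνr]
      exact conv_withDensity μ hr
    have hmeas : Measurable fun x => ∫⁻ y, r (x - y) ∂μ :=
      Measurable.lintegral_prod_right' (f := fun p : ℝ × ℝ => r (p.1 - p.2)) (by fun_prop)
    filter_upwards [Measure.rnDeriv_withDensity volume hmeas,
      Measure.rnDeriv_lt_top (μ ∗ ν) volume] with x hx hxt
    rw [hg, density, ENNReal.ofReal_toReal hxt.ne, h1, hx]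
  have hg0 : ∀ x, 0 ≤ g x := density_nonneg _
  have hgi : Integrable g := Measure.integrable_toReal_rnDeriv
  -- for fixed `x`, the integral over `y` of the truncated density against `l`
  have hx : ∀ᵐ x, ∫⁻ y, q (x - y) * ENNReal.ofReal (l y) ∂μ
      ≤ ENNReal.ofReal (|Real.negMulLog (g x)| + g x * (1 + |Real.log M|)) := by
    filter_upwards [hgd] with x hgx
    have hsupp : ∀ y, q (x - y) ≠ 0 → x - y ∈ A := fun y hy => by
      by_contra h
      exact hy (Set.indicator_of_notMem h _)
    have hIcc : ∀ y, x - y ∈ A → y ∈ Set.Icc (x - M) (x + M) := fun y hy => by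
      have := abs_le.1 hy.1
      exact ⟨by linarith, by linarith⟩
    have hqa : ∫⁻ y, q (x - y) ∂μ ≤ ENNReal.ofReal M * m M x := by
      calc ∫⁻ y, q (x - y) ∂μ
          ≤ ∫⁻ y, (Set.Icc (x - M) (x + M)).indicator (fun _ => ENNReal.ofReal M) y ∂μ := by
            refine lintegral_mono fun y => ?_
            by_cases hy : x - y ∈ A
            · rw [Set.indicator_of_mem (hIcc y hy), hq, Set.indicator_of_mem hy]
              exact hy.2
            · rw [hq, Set.indicator_of_notMem hy]; exact zero_le
        _ = _ := by rw [lintegral_indicator measurableSet_Icc]; simp [hm]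
    have hqg : ∫⁻ y, q (x - y) ∂μ ≤ ENNReal.ofReal (g x) := by
      rw [← hgx]
      exact lintegral_mono fun y => Set.indicator_le_self _ _ _
    have hle : ∫⁻ y, q (x - y) * ENNReal.ofReal (l y) ∂μ
        ≤ (∫⁻ y, q (x - y) ∂μ) * ENNReal.ofReal (-Real.log (m M x).toReal) := by
      -- A null ball is treated apart, as `Real.log 0 = 0` makes the right side vanish; the left
      -- side vanishes too, because `q (x - ·)` lives on that ball.
      rcases eq_or_ne (m M x) 0 with h0 | h0
      · have hae : ∀ᵐ y ∂μ, y ∉ Set.Icc (x - M) (x + M) := measure_eq_zero_iff_ae_notMem.1 h0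
        have : ∫⁻ y, q (x - y) * ENNReal.ofReal (l y) ∂μ = ∫⁻ _, 0 ∂μ := by
          refine lintegral_congr_ae ?_
          filter_upwards [hae] with y hy
          have : q (x - y) = 0 := by
            by_contra h
            exact hy (hIcc y (hsupp y h))
          rw [this, zero_mul]
        rw [this, lintegral_zero]; exact zero_le
      · rw [← lintegral_mul_const _ (by fun_prop)]
        refine lintegral_mono fun y => ?_
        by_cases hy : x - y ∈ A
        · gcongr
          have h2 := hIcc y hy
          simp only [hl]
          refine neg_le_neg (Real.log_le_log (ENNReal.toReal_pos h0 (measure_ne_top _ _)) ?_)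
          refine ENNReal.toReal_mono (measure_ne_top _ _) (measure_mono ?_)
          exact Set.Icc_subset_Icc (by linarith [h2.1, h2.2]) (by linarith [h2.1, h2.2])
        · rw [hq, Set.indicator_of_notMem hy]; simp
    refine hle.trans ?_
    have hfin : ∫⁻ y, q (x - y) ∂μ ≠ ⊤ := (hqg.trans_lt ENNReal.ofReal_lt_top).ne
    rw [← ENNReal.ofReal_toReal hfin, ← ENNReal.ofReal_mul ENNReal.toReal_nonneg]
    refine ENNReal.ofReal_le_ofReal
      (mul_neg_log_le ENNReal.toReal_nonneg ?_ hM ENNReal.toReal_nonneg ?_)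
    · exact ENNReal.toReal_le_of_le_ofReal (hg0 x) hqg
    · have := ENNReal.toReal_mono (ENNReal.mul_ne_top ENNReal.ofReal_ne_top (measure_ne_top _ _)) hqa
      rwa [ENNReal.toReal_mul, ENNReal.toReal_ofReal hM.le] at this
  have hfinite : ∫⁻ x, ∫⁻ y, q (x - y) * ENNReal.ofReal (l y) ∂μ < ⊤ :=
    (lintegral_mono_ae hx).trans_lt (hint.abs.add (hgi.mul_const _)).lintegral_lt_top
  -- Integrating in `x` first, translation invariance factors out `∫ q`, which is nonzero by the
  -- choice of `M`.
  rw [lintegral_lintegral_swap (by fun_prop)] at hfinite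
  have hinner : ∀ y, ∫⁻ x, q (x - y) * ENNReal.ofReal (l y)
      = (∫⁻ u, q u) * ENNReal.ofReal (l y) := fun y => by
    rw [lintegral_mul_const _ (by fun_prop), lintegral_sub_right_eq_self q y]
  simp_rw [hinner] at hfinite
  rw [lintegral_const_mul _ (by fun_prop)] at hfinite
  refine ⟨2 * M, l, by positivity, ⟨hlm.aestronglyMeasurable, ?_⟩, hl0, ?_⟩
  · rw [hasFiniteIntegral_iff_ofReal (ae_of_all _ hl0)]
    by_contra htop
    rw [not_lt, top_le_iff] at htop
    rw [htop, ENNReal.mul_top hMne] at hfinite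
    exact lt_irrefl _ hfinite
  · filter_upwards [ae_measure_Icc_pos μ (L := 2 * M) (by positivity)] with y hy
    rw [hl, neg_neg, Real.exp_log (ENNReal.toReal_pos hy.ne' (measure_ne_top _ _))]
    rfl

/-! ### The heat kernel and its Gaussian bounds. -/

/-- The density of the centred Gaussian law of variance `t`. -/
def heatKernel (t u : ℝ) : ℝ := (√(2 * Real.pi * t))⁻¹ * Real.exp (-u ^ 2 / (2 * t))

/-- The first space derivative of the heat kernel. -/
def heatKernelDx (t u : ℝ) : ℝ := -(u / t) * heatKernel t u

/-- The second space derivative of the heat kernel. -/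
def heatKernelDxx (t u : ℝ) : ℝ := (u ^ 2 / t ^ 2 - 1 / t) * heatKernel t u

theorem heatKernel_pos {t : ℝ} (ht : 0 < t) (u : ℝ) : 0 < heatKernel t u := by
  unfold heatKernel; positivity

theorem continuous_heatKernel (t : ℝ) : Continuous (heatKernel t) := by
  unfold heatKernel; fun_prop

theorem continuous_heatKernelDx (t : ℝ) : Continuous (heatKernelDx t) := by
  unfold heatKernelDx
  have := continuous_heatKernel t
  fun_prop

theorem continuous_heatKernelDxx (t : ℝ) : Continuous (heatKernelDxx t) := by
  unfold heatKernelDxx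
  have := continuous_heatKernel t
  fun_prop

theorem hasDerivAt_heatKernel (t u : ℝ) :
    HasDerivAt (heatKernel t) (heatKernelDx t u) u := by
  have h : HasDerivAt (fun u : ℝ => -u ^ 2 / (2 * t)) (-(u / t)) u := by
    have := (((hasDerivAt_id u).pow 2).neg).div_const (2 * t)
    refine (this.congr_deriv ?_)
    simp only [id]
    rw [neg_div, neg_inj]
    push_cast
    rw [pow_one, mul_one, mul_div_mul_left _ _ two_ne_zero]
  refine (h.exp.const_mul (√(2 * Real.pi * t))⁻¹).congr_deriv ?_
  unfold heatKernelDx heatKernel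
  ring

theorem hasDerivAt_heatKernelDx (t u : ℝ) :
    HasDerivAt (heatKernelDx t) (heatKernelDxx t u) u := by
  have h := (((hasDerivAt_id u).div_const t).neg).mul (hasDerivAt_heatKernel t u)
  refine h.congr_deriv ?_
  simp only [heatKernelDxx, heatKernelDx, id, Pi.neg_apply]
  ring

/-- The heat equation for the heat kernel. -/
theorem hasDerivAt_heatKernel_time {t : ℝ} (ht : 0 < t) (u : ℝ) :
    HasDerivAt (fun s => heatKernel s u) (1 / 2 * heatKernelDxx t u) t := by
  have h1 : HasDerivAt (fun s : ℝ => 2 * Real.pi * s) (2 * Real.pi) t := by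
    simpa using (hasDerivAt_id t).const_mul (2 * Real.pi)
  have hp : 0 < 2 * Real.pi * t := by positivity
  have hsq : √(2 * Real.pi * t) ^ 2 = 2 * Real.pi * t := Real.sq_sqrt hp.le
  have hs : 0 < √(2 * Real.pi * t) := Real.sqrt_pos.2 hp
  have h2 := (h1.sqrt hp.ne').inv hs.ne'
  have h3 : HasDerivAt (fun s : ℝ => -u ^ 2 / (2 * s)) (u ^ 2 / (2 * t ^ 2)) t := by
    have := ((hasDerivAt_const t (-u ^ 2)).div ((hasDerivAt_id t).const_mul 2)
      (by simpa using ht.ne'))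
    refine this.congr_deriv ?_
    simp only [id]
    field_simp
    ring
  refine (h2.mul h3.exp).congr_deriv ?_
  unfold heatKernelDxx heatKernel
  rw [hsq]
  simp only [Pi.inv_apply]
  field_simp
  ring

/-- Half of the Gaussian rate is given up to absorb a quartic polynomial: one factor `1 + u²` comes
from the derivatives of the kernel, the other from the bound on the logarithm. -/
theorem sq_one_add_sq_le {c : ℝ} (hc : 0 < c) :
    ∃ K, 0 < K ∧ ∀ u : ℝ, (1 + u ^ 2) ^ 2 * Real.exp (-(2 * c) * u ^ 2)
      ≤ K * Real.exp (-c * u ^ 2) := by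
  refine ⟨2 + 4 / c ^ 2, by positivity, fun u => ?_⟩
  have h1 : Real.exp (-(2 * c) * u ^ 2) = Real.exp (-c * u ^ 2) * Real.exp (-c * u ^ 2) := by
    rw [← Real.exp_add]; ring_nf
  have h2 : (1 + u ^ 2) ^ 2 ≤ (2 + 4 / c ^ 2) * Real.exp (c * u ^ 2) := by
    have h3 := Real.quadratic_le_exp_of_nonneg (x := c * u ^ 2) (by positivity)
    have h4 : (1 : ℝ) ≤ Real.exp (c * u ^ 2) := Real.one_le_exp (by positivity)
    have h5 : u ^ 4 * c ^ 2 ≤ 2 * Real.exp (c * u ^ 2) := by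
      nlinarith [show 0 ≤ c * u ^ 2 by positivity]
    have h6 : 2 * u ^ 4 ≤ 4 / c ^ 2 * Real.exp (c * u ^ 2) := by
      rw [div_mul_eq_mul_div, le_div_iff₀ (by positivity)]
      linarith
    nlinarith [sq_nonneg (u ^ 2 - 1)]
  rw [h1, ← mul_assoc]
  gcongr
  calc (1 + u ^ 2) ^ 2 * Real.exp (-c * u ^ 2)
      ≤ (2 + 4 / c ^ 2) * Real.exp (c * u ^ 2) * Real.exp (-c * u ^ 2) := by gcongr
    _ = 2 + 4 / c ^ 2 := by rw [mul_assoc, ← Real.exp_add]; simp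

theorem heatKernel_le {a b t : ℝ} (ha : 0 < a) (hat : a ≤ t) (htb : t ≤ b) (u : ℝ) :
    heatKernel t u ≤ (√(2 * Real.pi * a))⁻¹ * Real.exp (-u ^ 2 / (2 * b)) := by
  have ht : 0 < t := ha.trans_le hat
  unfold heatKernel
  gcongr ?_ * ?_
  · gcongr
  · rw [Real.exp_le_exp, neg_div, neg_div]
    gcongr

theorem le_heatKernel {a b t : ℝ} (ha : 0 < a) (hat : a ≤ t) (htb : t ≤ b) (u : ℝ) :
    (√(2 * Real.pi * b))⁻¹ * Real.exp (-u ^ 2 / (2 * a)) ≤ heatKernel t u := by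
  have ht : 0 < t := ha.trans_le hat
  unfold heatKernel
  gcongr ?_ * ?_
  · gcongr
  · rw [Real.exp_le_exp, neg_div, neg_div]
    gcongr

/-- A kernel which is dominated by the Gaussian `K exp (-c u²)`, with a quadratic gain. -/
structure GaussDominated (K c : ℝ) (κ : ℝ → ℝ) : Prop where
  continuous : Continuous κ
  bound : ∀ u, (1 + u ^ 2) * |κ u| ≤ K * Real.exp (-c * u ^ 2)

/-- On a compact time interval the heat kernel and its derivatives have a common Gaussian bound. -/
theorem exists_gaussDominated_heatKernel {a b : ℝ} (ha : 0 < a) (hab : a ≤ b) :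
    ∃ K c, 0 < K ∧ 0 < c ∧ ∀ t, a ≤ t → t ≤ b → GaussDominated K c (heatKernel t) ∧
      GaussDominated K c (heatKernelDx t) ∧ GaussDominated K c (heatKernelDxx t) := by
  have hb : 0 < b := ha.trans_le hab
  obtain ⟨K, hK, hKu⟩ := sq_one_add_sq_le (c := 1 / (4 * b)) (by positivity)
  set D := (√(2 * Real.pi * a))⁻¹ with hD
  have hDpos : 0 < D := by positivity
  -- Chosen so that `A (1 + u²)` dominates `1`, `|u / t|` and `|u² / t² - 1 / t|` for all `t ≥ a`.
  set A := 1 + 1 / a + 1 / a ^ 2 with hA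
  have key : ∀ t, a ≤ t → t ≤ b → ∀ κ : ℝ → ℝ, (∀ u, |κ u| ≤ A * (1 + u ^ 2) * heatKernel t u) →
      ∀ u, (1 + u ^ 2) * |κ u| ≤ A * D * K * Real.exp (-(1 / (4 * b)) * u ^ 2) := by
    intro t hat htb κ hκ u
    have h1 := heatKernel_le ha hat htb u
    have h2 : Real.exp (-u ^ 2 / (2 * b)) = Real.exp (-(2 * (1 / (4 * b))) * u ^ 2) := by
      congr 1; field_simp; ring
    calc (1 + u ^ 2) * |κ u|
        ≤ (1 + u ^ 2) * (A * (1 + u ^ 2) * (D * Real.exp (-u ^ 2 / (2 * b)))) := by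
          gcongr
          exact (hκ u).trans (by gcongr)
      _ = A * D * ((1 + u ^ 2) ^ 2 * Real.exp (-(2 * (1 / (4 * b))) * u ^ 2)) := by
          rw [h2]; ring
      _ ≤ A * D * (K * Real.exp (-(1 / (4 * b)) * u ^ 2)) :=
          mul_le_mul_of_nonneg_left (hKu u) (by positivity)
      _ = _ := by ring
  refine ⟨A * D * K, 1 / (4 * b), by positivity, by positivity, fun t hat htb => ?_⟩
  have ht : 0 < t := ha.trans_le hat
  have hi1 : 1 / t ≤ 1 / a := by gcongr
  have hi2 : 1 / t ^ 2 ≤ 1 / a ^ 2 := by gcongr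
  have hp1 : 0 < 1 / a := by positivity
  have hp2 : 0 < 1 / a ^ 2 := by positivity
  have hq1 : 0 < 1 / t := by positivity
  have hq2 : 0 < 1 / t ^ 2 := by positivity
  refine ⟨⟨continuous_heatKernel t, key t hat htb _ fun u => ?_⟩,
    ⟨continuous_heatKernelDx t, key t hat htb _ fun u => ?_⟩,
    ⟨continuous_heatKernelDxx t, key t hat htb _ fun u => ?_⟩⟩
  · rw [abs_of_pos (heatKernel_pos ht u)]
    refine le_mul_of_one_le_left (heatKernel_pos ht u).le ?_
    nlinarith [sq_nonneg u]
  · rw [heatKernelDx, abs_mul, abs_of_pos (heatKernel_pos ht u)]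
    refine mul_le_mul_of_nonneg_right ?_ (heatKernel_pos ht u).le
    rw [abs_neg, abs_div, abs_of_pos ht, div_eq_mul_one_div]
    refine mul_comm A _ ▸ mul_le_mul ?_ (by linarith) hq1.le (by positivity)
    nlinarith [sq_abs u, sq_nonneg (|u| - 1)]
  · rw [heatKernelDxx, abs_mul, abs_of_pos (heatKernel_pos ht u)]
    refine mul_le_mul_of_nonneg_right ?_ (heatKernel_pos ht u).le
    rw [div_eq_mul_one_div, abs_le]
    constructor
    · nlinarith [mul_nonneg (sq_nonneg u) hq2.le, mul_nonneg (sq_nonneg u) hp2.le,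
        mul_nonneg (sq_nonneg u) hp1.le, sq_nonneg u]
    · nlinarith [mul_le_mul_of_nonneg_left hi2 (sq_nonneg u), mul_nonneg (sq_nonneg u) hp2.le,
        mul_nonneg (sq_nonneg u) hp1.le, sq_nonneg u]

/-! ### Smoothing a measure by a Gaussian-dominated kernel. -/

/-- The convolution of the kernel `κ` with the measure `μ`. -/
def smoothing (μ : Measure ℝ) (κ : ℝ → ℝ) (x : ℝ) : ℝ := ∫ y, κ (x - y) ∂μ

/-- The majorant `∫ exp (-c (x - y)²) (1 + l y) dμ(y)`. -/
def gaussMajorant (μ : Measure ℝ) (c : ℝ) (l : ℝ → ℝ) (x : ℝ) : ℝ :=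
  ∫ y, Real.exp (-c * (x - y) ^ 2) * (1 + l y) ∂μ

section Smoothing

variable {μ : Measure ℝ} {K c L : ℝ} {κ κ' l : ℝ → ℝ}

theorem GaussDominated.abs_le (h : GaussDominated K c κ) (u : ℝ) :
    |κ u| ≤ K * Real.exp (-c * u ^ 2) := by
  refine le_trans ?_ (h.bound u)
  refine le_mul_of_one_le_left (abs_nonneg _) ?_
  nlinarith [sq_nonneg u]

theorem GaussDominated.abs_le_const (h : GaussDominated K c κ) (hK : 0 < K) (hc : 0 < c) (u : ℝ) :
    |κ u| ≤ K := by
  refine (h.abs_le u).trans (mul_le_of_le_one_right hK.le ?_)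
  rw [Real.exp_le_one_iff]
  nlinarith [mul_nonneg hc.le (sq_nonneg u)]

theorem GaussDominated.integrable [IsFiniteMeasure μ] (h : GaussDominated K c κ) (hK : 0 < K)
    (hc : 0 < c) (x : ℝ) : Integrable (fun y => κ (x - y)) μ := by
  have := h.continuous
  exact Integrable.of_bound (C := K) (by fun_prop)
    (ae_of_all _ fun y => h.abs_le_const hK hc _)

theorem GaussDominated.abs_smoothing_le [IsProbabilityMeasure μ] (h : GaussDominated K c κ)
    (hK : 0 < K) (hc : 0 < c) (x : ℝ) : |smoothing μ κ x| ≤ K := by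
  have := norm_integral_le_of_norm_le_const (μ := μ) (f := fun y => κ (x - y)) (C := K)
    (ae_of_all _ fun y => h.abs_le_const hK hc (x - y))
  simpa [smoothing] using this

theorem measurable_smoothing [SFinite μ] (hκ : Continuous κ) : Measurable (smoothing μ κ) := by
  have : StronglyMeasurable fun p : ℝ × ℝ => κ (p.1 - p.2) :=
    (by fun_prop : Continuous fun p : ℝ × ℝ => κ (p.1 - p.2)).stronglyMeasurable
  exact this.integral_prod_right'.measurable

theorem GaussDominated.hasDerivAt_smoothing [IsFiniteMeasure μ] (h : GaussDominated K c κ)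
    (h' : GaussDominated K c κ') (hK : 0 < K) (hc : 0 < c)
    (hd : ∀ u, HasDerivAt κ (κ' u) u) (x : ℝ) :
    HasDerivAt (smoothing μ κ) (smoothing μ κ' x) x := by
  have h1 := h.continuous
  have h2 := h'.continuous
  refine (hasDerivAt_integral_of_dominated_loc_of_deriv_le (bound := fun _ => K)
    (F := fun x y => κ (x - y)) (F' := fun x y => κ' (x - y)) (s := Set.univ) Filter.univ_mem
    (Filter.Eventually.of_forall fun x => by fun_prop) (h.integrable hK hc x) (by fun_prop)
    (ae_of_all _ fun y z _ => h'.abs_le_const hK hc _) (integrable_const _)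
    (ae_of_all _ fun y z _ => ?_)).2
  exact (hd (z - y)).comp_sub_const z y

theorem hasDerivAt_smoothing_time [IsFiniteMeasure μ] {k k' : ℝ → ℝ → ℝ} {a b : ℝ}
    (hk : ∀ t, a ≤ t → t ≤ b → GaussDominated K c (k t) ∧ GaussDominated K c (k' t))
    (hK : 0 < K) (hc : 0 < c)
    (hd : ∀ t, a ≤ t → t ≤ b → ∀ u, HasDerivAt (fun s => k s u) (1 / 2 * k' t u) t) {t : ℝ}
    (hat : a < t) (htb : t < b) (x : ℝ) :
    HasDerivAt (fun s => smoothing μ (k s) x) (1 / 2 * smoothing μ (k' t) x) t := by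
  have hn : Set.Icc a b ∈ nhds t := Icc_mem_nhds hat htb
  have h2 := (hk t hat.le htb.le).2.continuous
  have := (hasDerivAt_integral_of_dominated_loc_of_deriv_le (μ := μ) (bound := fun _ => 1 / 2 * K)
    (F := fun s y => k s (x - y)) (F' := fun s y => 1 / 2 * k' s (x - y)) (s := Set.Icc a b) hn
    ?_ ((hk t hat.le htb.le).1.integrable hK hc x) (by fun_prop)
    (ae_of_all _ fun y s hs => ?_) (integrable_const _)
    (ae_of_all _ fun y s hs => hd s hs.1 hs.2 _)).2
  · rwa [integral_const_mul] at this
  · filter_upwards [hn] with s hs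
    have := (hk s hs.1 hs.2).1.continuous
    fun_prop
  · rw [Real.norm_eq_abs, abs_mul, abs_of_pos (by norm_num : (0 : ℝ) < 1 / 2)]
    gcongr
    exact (hk s hs.1 hs.2).2.abs_le_const hK hc _

theorem integrable_gauss_mul [IsFiniteMeasure μ] (hc : 0 < c) (hl : Integrable l μ) (x : ℝ) :
    Integrable (fun y => Real.exp (-c * (x - y) ^ 2) * (1 + l y)) μ := by
  refine ((integrable_const (1 : ℝ)).add hl).bdd_mul (c := 1) (by fun_prop) (ae_of_all _ fun y => ?_)
  rw [Real.norm_eq_abs, Real.abs_exp, Real.exp_le_one_iff]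
  nlinarith [mul_nonneg hc.le (sq_nonneg (x - y))]

/-- Integrating in `x` first leaves the Gaussian mass times `∫ ‖1 + l‖ dμ`. -/
theorem integrable_gaussMajorant [IsFiniteMeasure μ] (hc : 0 < c) (hl : Integrable l μ) :
    Integrable (gaussMajorant μ c l) := by
  have h1 : Integrable (fun u : ℝ => Real.exp (-c * u ^ 2)) := integrable_exp_neg_mul_sq hc
  have h2 : Integrable (fun y => 1 + l y) μ := (integrable_const _).add hl
  have h3 : Integrable (fun p : ℝ × ℝ => Real.exp (-c * (p.1 - p.2) ^ 2) * (1 + l p.2))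
      (volume.prod μ) := by
    have hm : Continuous fun p : ℝ × ℝ => Real.exp (-c * (p.1 - p.2) ^ 2) := by fun_prop
    refine (integrable_prod_iff'
      (hm.aestronglyMeasurable.mul h2.aestronglyMeasurable.comp_snd)).2
      ⟨ae_of_all _ fun y => (h1.comp_sub_right y).mul_const (1 + l y), ?_⟩
    have : ∀ y, ∫ x, ‖Real.exp (-c * (x - y) ^ 2) * (1 + l y)‖
        = (∫ u, Real.exp (-c * u ^ 2)) * ‖1 + l y‖ := fun y => by
      simp_rw [norm_mul, Real.norm_eq_abs, Real.abs_exp]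
      rw [integral_mul_const, integral_sub_right_eq_self (fun u => Real.exp (-c * u ^ 2)) y]
    exact (h2.norm.const_mul _).congr (ae_of_all _ fun y => (this y).symm)
  exact h3.integral_prod_left

/-- If `B` is bounded by the weight `C (1 + (x - y)²) (1 + l y)` for almost every `y`, then its
product with a smoothed kernel is bounded by the Gaussian majorant. -/
theorem GaussDominated.abs_smoothing_mul_le [IsFiniteMeasure μ] (h : GaussDominated K c κ)
    (hK : 0 < K) (hc : 0 < c) (hl : Integrable l μ) (hl0 : ∀ y, 0 ≤ l y) {C B x : ℝ}
    (hB0 : 0 ≤ B) (hC : 0 ≤ C)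
    (hB : ∀ᵐ y ∂μ, B ≤ C * (1 + (x - y) ^ 2) * (1 + l y)) :
    |smoothing μ κ x| * B ≤ K * C * gaussMajorant μ c l x := by
  -- `B` depends on `x` only, so it can be moved inside the integral over `y` and estimated there
  -- with the same `y`.
  have h1 : |smoothing μ κ x| * B ≤ ∫ y, |κ (x - y)| * B ∂μ := by
    rw [integral_mul_const]
    exact mul_le_mul_of_nonneg_right (abs_integral_le_integral_abs) hB0
  refine h1.trans ?_
  rw [gaussMajorant, ← integral_const_mul]
  refine integral_mono_ae ((h.integrable hK hc x).abs.mul_const _)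
    ((integrable_gauss_mul hc hl x).const_mul _) ?_
  filter_upwards [hB] with y hy
  have hl1 : 0 ≤ 1 + l y := by linarith [hl0 y]
  calc |κ (x - y)| * B ≤ |κ (x - y)| * (C * (1 + (x - y) ^ 2) * (1 + l y)) := by gcongr
    _ = (1 + (x - y) ^ 2) * |κ (x - y)| * (C * (1 + l y)) := by ring
    _ ≤ K * Real.exp (-c * (x - y) ^ 2) * (C * (1 + l y)) :=
        mul_le_mul_of_nonneg_right (h.bound _) (by positivity)
    _ = _ := by ring

/-! ### Bounds on the smoothed density and its logarithm. -/

/-- The density of `X + √t Z`, where `X` has the law `μ`. -/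
def heatFlow (μ : Measure ℝ) (t : ℝ) : ℝ → ℝ := smoothing μ (heatKernel t)

theorem integrable_heatKernel [IsFiniteMeasure μ] {t : ℝ} (ht : 0 < t) (x : ℝ) :
    Integrable (fun y => heatKernel t (x - y)) μ := by
  obtain ⟨K, c, hK, hc, h⟩ := exists_gaussDominated_heatKernel ht le_rfl
  exact (h t le_rfl le_rfl).1.integrable hK hc x

theorem heatFlow_pos [IsProbabilityMeasure μ] {t : ℝ} (ht : 0 < t) (x : ℝ) :
    0 < heatFlow μ t x := by
  rw [heatFlow, smoothing, integral_pos_iff_support_of_nonneg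
    (fun y => (heatKernel_pos ht _).le) (integrable_heatKernel ht x)]
  have : Function.support (fun y => heatKernel t (x - y)) = Set.univ :=
    Set.eq_univ_of_forall fun y => (heatKernel_pos ht _).ne'
  simp [this]

theorem heatFlow_le [IsProbabilityMeasure μ] {a t : ℝ} (ha : 0 < a) (hat : a ≤ t) (x : ℝ) :
    heatFlow μ t x ≤ (√(2 * Real.pi * a))⁻¹ := by
  have ht : 0 < t := ha.trans_le hat
  have h := integral_mono (μ := μ) (integrable_heatKernel ht x)
    (integrable_const (√(2 * Real.pi * a))⁻¹) fun y => ?_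
  · simpa [heatFlow, smoothing] using h
  · refine (heatKernel_le ha hat le_rfl _).trans (mul_le_of_le_one_right (by positivity) ?_)
    rw [Real.exp_le_one_iff, neg_div]
    exact neg_nonpos.2 (by positivity)

/-- A lower bound of the smoothed density by the mass of balls. -/
theorem le_heatFlow [IsProbabilityMeasure μ] {a b t : ℝ} (ha : 0 < a) (hat : a ≤ t) (htb : t ≤ b)
    (hL : 0 < L) (x y : ℝ) :
    (√(2 * Real.pi * b))⁻¹ * Real.exp (-(|x - y| + L) ^ 2 / (2 * a))
      * μ.real (Set.Icc (y - L) (y + L)) ≤ heatFlow μ t x := by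
  have ht : 0 < t := ha.trans_le hat
  set B := (√(2 * Real.pi * b))⁻¹ * Real.exp (-(|x - y| + L) ^ 2 / (2 * a)) with hB
  calc B * μ.real (Set.Icc (y - L) (y + L))
      = ∫ _ in Set.Icc (y - L) (y + L), B ∂μ := by simp [mul_comm]
    _ ≤ ∫ z in Set.Icc (y - L) (y + L), heatKernel t (x - z) ∂μ := by
        refine setIntegral_mono_on (integrable_const B) (integrable_heatKernel ht x).integrableOn
          measurableSet_Icc fun z hz => ?_
        refine le_trans ?_ (le_heatKernel ha hat htb _)
        rw [hB]
        gcongr ?_ * Real.exp ?_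
        rw [neg_div, neg_div, neg_le_neg_iff]
        refine div_le_div_of_nonneg_right ?_ (by positivity)
        rw [sq_le_sq, abs_of_nonneg (by positivity : 0 ≤ |x - y| + L)]
        calc |x - z| = |(x - y) + (y - z)| := by ring_nf
          _ ≤ |x - y| + |y - z| := abs_add_le _ _
          _ ≤ _ := by
            gcongr
            rw [abs_le]
            exact ⟨by linarith [hz.2], by linarith [hz.1]⟩
    _ ≤ heatFlow μ t x :=
        setIntegral_le_integral (integrable_heatKernel ht x)
          (ae_of_all _ fun z => (heatKernel_pos ht _).le)

/-- The upper bound on the logarithm is uniform; the lower one uses only the mass of `μ` around `y`.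
The freedom of `y` is essential, since no fixed `y` would give integrability without moments. The
extra `1` covers the `log p + 1` of the derivative. -/
theorem exists_abs_log_heatFlow_le [IsProbabilityMeasure μ] (hL : 0 < L)
    (hl : HasLogIntegrableBalls μ L l) {a b : ℝ} (ha : 0 < a) (hab : a ≤ b) :
    ∃ C, 0 ≤ C ∧ ∀ t, a ≤ t → t ≤ b → ∀ x, ∀ᵐ y ∂μ,
      |Real.log (heatFlow μ t x)| + 1 ≤ C * (1 + (x - y) ^ 2) * (1 + l y) := by
  obtain ⟨-, hl0, hlb⟩ := hl
  have hb : 0 < b := ha.trans_le hab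
  set A := |Real.log (√(2 * Real.pi * a))⁻¹| with hA
  set B := |Real.log (√(2 * Real.pi * b))⁻¹| with hB
  refine ⟨A + B + (1 + L ^ 2) / a + 2, by positivity, fun t hat htb x => ?_⟩
  have ht : 0 < t := ha.trans_le hat
  filter_upwards [hlb] with y hy
  have hly := hl0 y
  have hpos := heatFlow_pos (μ := μ) ht x
  have hup : Real.log (heatFlow μ t x) ≤ A :=
    (Real.log_le_log hpos (heatFlow_le ha hat x)).trans (le_abs_self _)
  have hlow : -(B + (|x - y| + L) ^ 2 / (2 * a) + l y) ≤ Real.log (heatFlow μ t x) := by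
    have h1 := le_heatFlow (μ := μ) ha hat htb hL x y
    have h2 : (√(2 * Real.pi * b))⁻¹ * Real.exp (-(|x - y| + L) ^ 2 / (2 * a)) * Real.exp (-l y)
        ≤ heatFlow μ t x := le_trans (by gcongr) h1
    have h3 := Real.log_le_log (by positivity) h2
    rw [Real.log_mul (by positivity) (by positivity), Real.log_mul (by positivity) (by positivity),
      Real.log_exp, Real.log_exp, neg_div] at h3
    linarith [neg_abs_le (Real.log (√(2 * Real.pi * b))⁻¹)]
  have hsq : (|x - y| + L) ^ 2 / (2 * a) ≤ (1 + L ^ 2) / a * (1 + (x - y) ^ 2) := by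
    rw [div_mul_eq_mul_div, div_le_div_iff₀ (by positivity) ha]
    have : (|x - y| + L) ^ 2 ≤ 2 * ((1 + L ^ 2) * (1 + (x - y) ^ 2)) := by
      nlinarith [sq_abs (x - y), sq_nonneg (|x - y| - L), sq_nonneg (x - y), sq_nonneg L,
        mul_nonneg (sq_nonneg (x - y)) (sq_nonneg L)]
    nlinarith
  have hA0 : 0 ≤ A := abs_nonneg _
  have hB0 : 0 ≤ B := abs_nonneg _
  have hD0 : 0 ≤ (1 + L ^ 2) / a := by positivity
  set D := (1 + L ^ 2) / a
  have hS0 := sq_nonneg (x - y)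
  set S := (x - y) ^ 2
  have hfin : A + B + D * (1 + S) + l y + 1 ≤ (A + B + D + 2) * (1 + S) * (1 + l y) := by
    have e1 : 0 ≤ (A + B) * S := by positivity
    have e2 : 0 ≤ (A + B + D + 1) * S * l y := by positivity
    have e3 : 0 ≤ (A + B + D + 1) * l y := by positivity
    have e4 : 0 ≤ S * l y := by positivity
    nlinarith
  have hT : 0 ≤ (|x - y| + L) ^ 2 / (2 * a) := by positivity
  have : |Real.log (heatFlow μ t x)| ≤ A + B + D * (1 + S) + l y :=
    abs_le.2 ⟨by linarith, by linarith [mul_nonneg hD0 (by positivity : 0 ≤ 1 + S)]⟩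
  linarith

end Smoothing

/-! ### The heat equation, differentiation of the entropy and integration by parts. -/

section HeatFlow

variable {μ : Measure ℝ} {L t : ℝ} {l : ℝ → ℝ}

/-- The space derivative of the smoothed density. -/
def heatFlowDx (μ : Measure ℝ) (t : ℝ) : ℝ → ℝ := smoothing μ (heatKernelDx t)

/-- The second space derivative of the smoothed density. -/
def heatFlowDxx (μ : Measure ℝ) (t : ℝ) : ℝ → ℝ := smoothing μ (heatKernelDxx t)

theorem measurable_heatFlow [SFinite μ] : Measurable (heatFlow μ t) :=
  measurable_smoothing (continuous_heatKernel t)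

theorem measurable_heatFlowDx [SFinite μ] : Measurable (heatFlowDx μ t) :=
  measurable_smoothing (continuous_heatKernelDx t)

theorem measurable_heatFlowDxx [SFinite μ] : Measurable (heatFlowDxx μ t) :=
  measurable_smoothing (continuous_heatKernelDxx t)

theorem hasDerivAt_heatFlow [IsFiniteMeasure μ] (ht : 0 < t) (x : ℝ) :
    HasDerivAt (heatFlow μ t) (heatFlowDx μ t x) x := by
  obtain ⟨K, c, hK, hc, h⟩ := exists_gaussDominated_heatKernel ht le_rfl
  obtain ⟨h0, h1, -⟩ := h t le_rfl le_rfl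
  exact h0.hasDerivAt_smoothing h1 hK hc (hasDerivAt_heatKernel t) x

theorem hasDerivAt_heatFlowDx [IsFiniteMeasure μ] (ht : 0 < t) (x : ℝ) :
    HasDerivAt (heatFlowDx μ t) (heatFlowDxx μ t x) x := by
  obtain ⟨K, c, hK, hc, h⟩ := exists_gaussDominated_heatKernel ht le_rfl
  obtain ⟨-, h1, h2⟩ := h t le_rfl le_rfl
  exact h1.hasDerivAt_smoothing h2 hK hc (hasDerivAt_heatKernelDx t) x

/-- The heat equation for the smoothed density. -/
theorem hasDerivAt_heatFlow_time [IsFiniteMeasure μ] (ht : 0 < t) (x : ℝ) :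
    HasDerivAt (fun s => heatFlow μ s x) (1 / 2 * heatFlowDxx μ t x) t := by
  obtain ⟨K, c, hK, hc, h⟩ := exists_gaussDominated_heatKernel (half_pos ht)
    (by linarith : t / 2 ≤ 2 * t)
  exact hasDerivAt_smoothing_time (a := t / 2) (b := 2 * t)
    (fun s h1 h2 => ⟨(h s h1 h2).1, (h s h1 h2).2.2⟩) hK hc
    (fun s h1 _ u => hasDerivAt_heatKernel_time (by linarith) u) (by linarith) (by linarith) x

/-- On a compact time interval, the smoothed density and its derivatives, multiplied by
`|log p| + 1`, have a common integrable majorant. -/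
theorem exists_integrable_majorant [IsProbabilityMeasure μ] (hL : 0 < L)
    (hl : HasLogIntegrableBalls μ L l) {a b : ℝ} (ha : 0 < a) (hab : a ≤ b) :
    ∃ G : ℝ → ℝ, Integrable G ∧ ∀ t, a ≤ t → t ≤ b → ∀ x,
      |heatFlow μ t x| * (|Real.log (heatFlow μ t x)| + 1) ≤ G x ∧
      |heatFlowDx μ t x| * (|Real.log (heatFlow μ t x)| + 1) ≤ G x ∧
      |heatFlowDxx μ t x| * (|Real.log (heatFlow μ t x)| + 1) ≤ G x := by
  obtain ⟨K, c, hK, hc, h⟩ := exists_gaussDominated_heatKernel ha hab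
  obtain ⟨C, hC, hB⟩ := exists_abs_log_heatFlow_le hL hl ha hab
  refine ⟨fun x => K * C * gaussMajorant μ c l x, (integrable_gaussMajorant hc hl.1).const_mul _,
    fun t hat htb x => ?_⟩
  obtain ⟨h0, h1, h2⟩ := h t hat htb
  have hB0 : 0 ≤ |Real.log (heatFlow μ t x)| + 1 := by positivity
  exact ⟨h0.abs_smoothing_mul_le hK hc hl.1 hl.2.1 hB0 hC (hB t hat htb x),
    h1.abs_smoothing_mul_le hK hc hl.1 hl.2.1 hB0 hC (hB t hat htb x),
    h2.abs_smoothing_mul_le hK hc hl.1 hl.2.1 hB0 hC (hB t hat htb x)⟩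

theorem abs_mul_log_add_one_le (q r : ℝ) : |q * (Real.log r + 1)| ≤ |q| * (|Real.log r| + 1) := by
  rw [abs_mul]
  gcongr
  exact (abs_add_le _ _).trans (by simp)

theorem abs_negMulLog_le (p : ℝ) : |Real.negMulLog p| ≤ |p| * (|Real.log p| + 1) := by
  rw [Real.negMulLog, abs_mul, abs_neg]
  gcongr
  linarith

section Integrability

variable [IsProbabilityMeasure μ] (hL : 0 < L) (hl : HasLogIntegrableBalls μ L l) (ht : 0 < t)

include hL hl ht

theorem integrable_negMulLog_heatFlow :
    Integrable fun x => Real.negMulLog (heatFlow μ t x) := by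
  obtain ⟨G, hG, h⟩ := exists_integrable_majorant hL hl ht le_rfl
  exact hG.mono' (Real.continuous_negMulLog.measurable.comp
    measurable_heatFlow).aestronglyMeasurable
    (ae_of_all _ fun x => (abs_negMulLog_le _).trans (h t le_rfl le_rfl x).1)

theorem integrable_heatFlowDx_mul_log :
    Integrable fun x => heatFlowDx μ t x * (Real.log (heatFlow μ t x) + 1) := by
  obtain ⟨G, hG, h⟩ := exists_integrable_majorant hL hl ht le_rfl
  refine hG.mono' ?_
    (ae_of_all _ fun x => (abs_mul_log_add_one_le _ _).trans (h t le_rfl le_rfl x).2.1)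
  exact (measurable_heatFlowDx.mul
    ((Real.measurable_log.comp measurable_heatFlow).add_const 1)).aestronglyMeasurable

theorem integrable_heatFlowDxx_mul_log :
    Integrable fun x => heatFlowDxx μ t x * (Real.log (heatFlow μ t x) + 1) := by
  obtain ⟨G, hG, h⟩ := exists_integrable_majorant hL hl ht le_rfl
  refine hG.mono' ?_
    (ae_of_all _ fun x => (abs_mul_log_add_one_le _ _).trans (h t le_rfl le_rfl x).2.2)
  exact (measurable_heatFlowDxx.mul
    ((Real.measurable_log.comp measurable_heatFlow).add_const 1)).aestronglyMeasurable

/-- Differentiation of the entropy along the heat flow under the integral sign. -/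
theorem hasDerivAt_integral_negMulLog_heatFlow :
    HasDerivAt (fun s => ∫ x, Real.negMulLog (heatFlow μ s x))
      (-(1 / 2) * ∫ x, heatFlowDxx μ t x * (Real.log (heatFlow μ t x) + 1)) t := by
  -- Any compact time interval in `(0, ∞)` with `t` in its interior would do.
  obtain ⟨G, hG, h⟩ := exists_integrable_majorant hL hl (half_pos ht)
    (by linarith : t / 2 ≤ 2 * t)
  have hn : Set.Icc (t / 2) (2 * t) ∈ nhds t := Icc_mem_nhds (by linarith) (by linarith)
  rw [← integral_const_mul]
  refine (hasDerivAt_integral_of_dominated_loc_of_deriv_le (bound := G)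
    (F := fun s x => Real.negMulLog (heatFlow μ s x))
    (F' := fun s x => -(1 / 2) * (heatFlowDxx μ s x * (Real.log (heatFlow μ s x) + 1)))
    (s := Set.Icc (t / 2) (2 * t)) hn (Filter.Eventually.of_forall fun s =>
      (Real.continuous_negMulLog.measurable.comp measurable_heatFlow).aestronglyMeasurable)
    (integrable_negMulLog_heatFlow hL hl ht)
    ((integrable_heatFlowDxx_mul_log hL hl ht).const_mul _).aestronglyMeasurable
    (ae_of_all _ fun x s hs => ?_) hG (ae_of_all _ fun x s hs => ?_)).2
  · rw [Real.norm_eq_abs, abs_mul]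
    refine (mul_le_of_le_one_left (abs_nonneg _) ?_).trans
      ((abs_mul_log_add_one_le _ _).trans (h s hs.1 hs.2 x).2.2)
    rw [abs_neg, abs_of_pos] <;> norm_num
  · have hs0 : 0 < s := (half_pos ht).trans_le hs.1
    refine ((Real.hasDerivAt_negMulLog (heatFlow_pos (μ := μ) hs0 x).ne').comp s
      (hasDerivAt_heatFlow_time hs0 x)).congr_deriv ?_
    ring

theorem integrable_heatFlow_and_heatFlowDxx :
    Integrable (heatFlow μ t) ∧ Integrable (heatFlowDxx μ t) := by
  obtain ⟨G, hG, h⟩ := exists_integrable_majorant hL hl ht le_rfl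
  constructor
  · exact hG.mono' (measurable_heatFlow).aestronglyMeasurable (ae_of_all _ fun x =>
      (le_mul_of_one_le_right (abs_nonneg _) (by simp)).trans (h t le_rfl le_rfl x).1)
  · exact hG.mono' measurable_heatFlowDxx.aestronglyMeasurable (ae_of_all _ fun x =>
      (le_mul_of_one_le_right (abs_nonneg _) (by simp)).trans (h t le_rfl le_rfl x).2.2)

omit hL hl in
/-- The Cauchy–Schwarz inequality for the score of the smoothed density. -/
theorem heatFlowDx_sq_div_le (x : ℝ) :
    heatFlowDx μ t x ^ 2 / heatFlow μ t x ≤ heatFlowDxx μ t x + heatFlow μ t x / t := by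
  obtain ⟨K, c, hK, hc, h⟩ := exists_gaussDominated_heatKernel ht le_rfl
  obtain ⟨h0, h1, h2⟩ := h t le_rfl le_rfl
  have hp := heatFlow_pos (μ := μ) ht x
  -- The score `s` minimizes the quadratic `∫ ((x - y)/t + s)² k dμ(y) = p'' + p/t - 2 s p' + s² p`,
  -- with `k` the heat kernel at `x - y`; nonnegativity of the minimum is the claim.
  set s := heatFlowDx μ t x / heatFlow μ t x with hs
  have hint : heatFlowDxx μ t x + 1 / t * heatFlow μ t x - 2 * s * heatFlowDx μ t x
      + s ^ 2 * heatFlow μ t x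
      = ∫ y, ((x - y) / t + s) ^ 2 * heatKernel t (x - y) ∂μ := by
    have e0 := h0.integrable (μ := μ) hK hc x
    have e1 := h1.integrable (μ := μ) hK hc x
    have e2 := h2.integrable (μ := μ) hK hc x
    simp only [heatFlowDxx, heatFlowDx, heatFlow, smoothing]
    have e3 : Integrable (fun y => heatKernelDxx t (x - y) + 1 / t * heatKernel t (x - y)) μ :=
      e2.add (e0.const_mul _)
    have e4 : Integrable (fun y => heatKernelDxx t (x - y) + 1 / t * heatKernel t (x - y)
        - 2 * s * heatKernelDx t (x - y)) μ := e3.sub (e1.const_mul _)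
    rw [← integral_const_mul, ← integral_const_mul, ← integral_const_mul,
      ← integral_add e2 (e0.const_mul _), ← integral_sub e3 (e1.const_mul _),
      ← integral_add e4 (e0.const_mul _)]
    refine integral_congr_ae (ae_of_all _ fun y => ?_)
    simp only [heatKernelDxx, heatKernelDx]
    ring
  have hnn : 0 ≤ ∫ y, ((x - y) / t + s) ^ 2 * heatKernel t (x - y) ∂μ :=
    integral_nonneg fun y => mul_nonneg (sq_nonneg _) (heatKernel_pos ht _).le
  rw [← hint] at hnn
  have h3 : s * heatFlowDx μ t x = heatFlowDx μ t x ^ 2 / heatFlow μ t x := by rw [hs]; ring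
  have h4 : s ^ 2 * heatFlow μ t x = heatFlowDx μ t x ^ 2 / heatFlow μ t x := by
    rw [hs]; field_simp
  rw [mul_assoc, h3, h4, one_div_mul_eq_div] at hnn
  linarith

/-- The pointwise bound by `p'' + p / t` gives finite Fisher information from the integrability of
`p` and `p''` alone. -/
theorem integrable_heatFlowDx_sq_div :
    Integrable fun x => heatFlowDx μ t x ^ 2 / heatFlow μ t x := by
  obtain ⟨h0, h2⟩ := integrable_heatFlow_and_heatFlowDxx hL hl ht
  refine (h2.add (h0.div_const t)).mono'
    ((measurable_heatFlowDx.pow_const 2).div measurable_heatFlow).aestronglyMeasurable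
    (ae_of_all _ fun x => ?_)
  rw [Real.norm_of_nonneg (div_nonneg (sq_nonneg _) (heatFlow_pos ht x).le)]
  exact heatFlowDx_sq_div_le ht x

/-- Integration by parts of `∫ p'' (log p + 1)`. -/
theorem integral_heatFlowDxx_mul_log :
    ∫ x, heatFlowDxx μ t x * (Real.log (heatFlow μ t x) + 1)
      = -∫ x, heatFlowDx μ t x ^ 2 / heatFlow μ t x := by
  -- The primitive is `p' (log p + 1)`. As it and its derivative `p'' (log p + 1) + p'² / p` are
  -- both integrable, no boundary terms remain.
  have h := integral_eq_zero_of_hasDerivAt_of_integrable (fun x => ?_)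
    ((integrable_heatFlowDxx_mul_log hL hl ht).add (integrable_heatFlowDx_sq_div hL hl ht))
    (integrable_heatFlowDx_mul_log hL hl ht)
  · rw [integral_add' (integrable_heatFlowDxx_mul_log hL hl ht)
      (integrable_heatFlowDx_sq_div hL hl ht)] at h
    linarith
  · refine ((hasDerivAt_heatFlowDx ht x).mul (((hasDerivAt_heatFlow ht x).log
      (heatFlow_pos ht x).ne').add_const 1)).congr_deriv ?_
    simp only [Pi.add_apply]
    ring

end Integrability

/-! ### Entropy and Fisher information of the perturbed law. -/

/-- The law of `X + √t Z` has the density `heatFlow μ t`. -/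
theorem conv_gaussianReal_eq [IsProbabilityMeasure μ] (ht : 0 < t) :
    μ ∗ gaussianReal 0 (NNReal.mk t ht.le)
      = volume.withDensity fun x => ENNReal.ofReal (heatFlow μ t x) := by
  have hne : NNReal.mk t ht.le ≠ 0 := fun h => ht.ne' (congrArg NNReal.toReal h)
  rw [gaussianReal_of_var_ne_zero 0 hne, conv_withDensity μ (measurable_gaussianPDF 0 _)]
  congr 1
  funext x
  rw [heatFlow, smoothing, ofReal_integral_eq_lintegral_ofReal (integrable_heatKernel ht x)
    (ae_of_all _ fun y => (heatKernel_pos ht _).le)]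
  refine lintegral_congr fun y => ?_
  simp [gaussianPDF, gaussianPDFReal, heatKernel]

theorem isACDensity_heatFlow [IsProbabilityMeasure μ] (ht : 0 < t) :
    IsACDensity (μ ∗ gaussianReal 0 (NNReal.mk t ht.le)) (heatFlow μ t) where
  nonneg x := (heatFlow_pos ht x).le
  absCont a b := by
    obtain ⟨K, c, hK, hc, h⟩ := exists_gaussDominated_heatKernel ht le_rfl
    -- Absolute continuity comes from the uniform bound on `p'`.
    have hlip : LipschitzWith ⟨K, hK.le⟩ (heatFlow μ t) := by
      refine lipschitzWith_of_nnnorm_deriv_le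
        (fun x => (hasDerivAt_heatFlow ht x).differentiableAt) fun x => ?_
      rw [(hasDerivAt_heatFlow ht x).deriv]
      exact (h t le_rfl le_rfl).2.1.abs_smoothing_le hK hc x
    exact hlip.lipschitzOnWith.absolutelyContinuousOnInterval
  eq_withDensity := conv_gaussianReal_eq ht

theorem lawEntropy_conv_gaussianReal [IsProbabilityMeasure μ] (hL : 0 < L)
    (hl : HasLogIntegrableBalls μ L l) (ht : 0 < t) :
    lawEntropy (μ ∗ gaussianReal 0 (NNReal.mk t ht.le))
      = ((∫ x, Real.negMulLog (heatFlow μ t x) : ℝ) : EReal) := by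
  rw [conv_gaussianReal_eq ht]
  have hd := density_withDensity_ofReal (f := heatFlow μ t) measurable_heatFlow
    fun x => (heatFlow_pos ht x).le
  have hae : (fun x => Real.negMulLog (density
      (volume.withDensity fun x => ENNReal.ofReal (heatFlow μ t x)) x))
      =ᵐ[volume] fun x => Real.negMulLog (heatFlow μ t x) := hd.fun_comp Real.negMulLog
  rw [lawEntropy_eq_integral (withDensity_absolutelyContinuous _ _)
    ((integrable_congr hae).2 (integrable_negMulLog_heatFlow hL hl ht)), integral_congr_ae hae]

theorem lawFisherInfo_conv_gaussianReal [IsProbabilityMeasure μ] (hL : 0 < L)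
    (hl : HasLogIntegrableBalls μ L l) (ht : 0 < t) :
    lawFisherInfo (μ ∗ gaussianReal 0 (NNReal.mk t ht.le))
      = ENNReal.ofReal (∫ x, heatFlowDx μ t x ^ 2 / heatFlow μ t x) := by
  rw [lawFisherInfo_eq (isACDensity_heatFlow ht), fisherIntegral,
    ofReal_integral_eq_lintegral_ofReal (integrable_heatFlowDx_sq_div hL hl ht)
      (ae_of_all _ fun x => div_nonneg (sq_nonneg _) (heatFlow_pos ht x).le)]
  refine lintegral_congr fun x => ?_
  rw [(hasDerivAt_heatFlow ht x).deriv]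

theorem map_add_sqrt_mul {Ω : Type*} [MeasurableSpace Ω] {P : Measure Ω} [IsProbabilityMeasure P]
    {X Z : Ω → ℝ} (hX : AEMeasurable X P) (hZ : HasLaw Z (gaussianReal 0 1) P)
    (hXZ : IndepFun X Z P) (ht : 0 < t) :
    P.map (fun ω => X ω + √t * Z ω) = P.map X ∗ gaussianReal 0 (NNReal.mk t ht.le) := by
  have h1 : HasLaw (fun ω => √t * Z ω) (gaussianReal 0 (NNReal.mk t ht.le)) P := by
    have := gaussianReal_const_mul hZ (√t)
    rw [mul_zero, mul_one] at this
    convert this using 2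
    ext
    simp [Real.sq_sqrt ht.le]
  have hind : IndepFun X (fun ω => √t * Z ω) P :=
    hXZ.comp measurable_id (measurable_const_mul _)
  rw [← h1.map_eq]
  exact hind.map_add_eq_map_conv_map₀ hX h1.aemeasurable

end HeatFlow

end DeBruijn

end

/-! ### De Bruijn's identity. -/

/-- The auxiliary variable `Y` may live on another probability space `Ω'`, next to a copy `X'`
of `X` that is independent of `Y`. -/
theorem theorem3 {Ω Ω' : Type*} [MeasurableSpace Ω] [MeasurableSpace Ω']
    (P : Measure Ω) [IsProbabilityMeasure P] (Q : Measure Ω') [IsProbabilityMeasure Q]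
    (X Z : Ω → ℝ) (X' Y : Ω' → ℝ)
    (hX : AEMeasurable X P)
    (hXtop : DeBruijn.entropy P X < ⊤)
    (hX' : IdentDistrib X' X Q P) (hY : AEMeasurable Y Q) (hXY : IndepFun X' Y Q)
    (hYfin : DeBruijn.HasFiniteEntropy Q Y)
    (hXYfin : DeBruijn.HasFiniteEntropy Q (fun ω => X' ω + Y ω))
    (hZ : HasLaw Z (gaussianReal 0 1) P) (hXZ : IndepFun X Z P) :
    ∀ t : ℝ, 0 < t →
      DeBruijn.HasFiniteEntropy P (fun ω => X ω + Real.sqrt t * Z ω) ∧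
      DeBruijn.fisherInfo P (fun ω => X ω + Real.sqrt t * Z ω) ≠ ⊤ ∧
      HasDerivAt
        (fun s : ℝ => (DeBruijn.entropy P (fun ω => X ω + Real.sqrt s * Z ω)).toReal)
        (1 / 2 * (DeBruijn.fisherInfo P (fun ω => X ω + Real.sqrt t * Z ω)).toReal) t := by
  have hXp : IsProbabilityMeasure (P.map X) := Measure.isProbabilityMeasure_map hX
  have hYp : IsProbabilityMeasure (Q.map Y) := Measure.isProbabilityMeasure_map hY
  have hlaw : Q.map (fun ω => X' ω + Y ω) = P.map X ∗ Q.map Y := by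
    rw [← hX'.map_eq]
    exact hXY.map_add_eq_map_conv_map₀ hX'.aemeasurable_fst hY
  have hYac : Q.map Y ≪ volume := DeBruijn.absolutelyContinuous_of_lawEntropy_ne_bot hYfin.1
  have hint := DeBruijn.integrable_negMulLog_density hXYfin.1 hXYfin.2
  rw [hlaw] at hint
  obtain ⟨L, l, hL, hl⟩ := DeBruijn.exists_hasLogIntegrableBalls _ _ hYac hint
  have hent : ∀ s : ℝ, 0 < s → DeBruijn.entropy P (fun ω => X ω + Real.sqrt s * Z ω)
      = ((∫ x, Real.negMulLog (DeBruijn.heatFlow (P.map X) s x) : ℝ) : EReal) := fun s hs => by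
    rw [DeBruijn.entropy, DeBruijn.map_add_sqrt_mul hX hZ hXZ hs,
      DeBruijn.lawEntropy_conv_gaussianReal hL hl hs]
  intro t ht
  have hfis : DeBruijn.fisherInfo P (fun ω => X ω + Real.sqrt t * Z ω)
      = ENNReal.ofReal (∫ x, DeBruijn.heatFlowDx (P.map X) t x ^ 2
          / DeBruijn.heatFlow (P.map X) t x) := by
    rw [DeBruijn.fisherInfo, DeBruijn.map_add_sqrt_mul hX hZ hXZ ht,
      DeBruijn.lawFisherInfo_conv_gaussianReal hL hl ht]
  refine ⟨⟨?_, ?_⟩, ?_, ?_⟩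
  · rw [hent t ht]; exact EReal.coe_ne_bot _
  · rw [hent t ht]; exact EReal.coe_ne_top _
  · rw [hfis]; exact ENNReal.ofReal_ne_top
  · rw [hfis, ENNReal.toReal_ofReal (integral_nonneg fun x =>
      div_nonneg (sq_nonneg _) (DeBruijn.heatFlow_pos ht x).le)]
    have h := DeBruijn.hasDerivAt_integral_negMulLog_heatFlow hL hl ht
    rw [DeBruijn.integral_heatFlowDxx_mul_log hL hl ht, neg_mul_neg] at h
    refine h.congr_of_eventuallyEq ?_
    -- The integral formula for the entropy is available only for `s > 0`, which holds near `t`.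
    filter_upwards [lt_mem_nhds ht] with s hs
    rw [hent s hs, EReal.toReal_coe]
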